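/- Let $n\ge 1$ and $N\ge n$. A discrete multiline queue (MLQ) of type $(1,\dots,1)$ on a ring of $N$ sites consists of $n$ rows with $N$ cyclically arranged columns $0,1,\dots,N-1$, the $i$-th row (from the top) holding exactly $i$ boxes, in distinct columns. The boxes are labelled row by row from the top. The single box of row $1$ has label $1$. When row $i$ has been labelled with $1,\dots,i$, one treats the labels $j=1,\dots,i$ in increasing order: $j$ is given to the first still unlabelled box of row $i+1$ found by going weakly to the right (cyclically) from the column of the box labelled $j$ in row $i$; the remaining box of row $i+1$ is labelled $i+1$. For a permutation $\pi$ of $\{1,\dots,n\}$ and $0\le b_1<\dots<b_n\le N-1$ let $G_\pi(b_1,\dots,b_n;N)$ be the number of MLQs whose bottom row carries the label $\pi_a$ in column $b_a$ for $a=1,\dots,n$, and let $Z_N=\prod_{i=1}^n\binom{N}{i}$ be the number of all MLQs. For $0\le q_1<\dots<q_n<1$ put $$g_\pi(q_1,\dots,q_n)=\lim_{N\to\infty}\frac{N^n}{Z_N}\,G_\pi(\lfloor Nq_1\rfloor,\dots,\lfloor Nq_n\rfloor;N).$$ Let $w_0=n(n-1)\cdots 1$ be the reverse permutation, and let $s_kw_0=n\cdots(k+2)\,k\,(k+1)\,(k-1)\cdots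 1$ be obtained from it by interchanging the letters $k$ and $k+1$. **Corollary.** Let $k\in\{1,2\}$ and $n>k$. Then the limits defining $g_{w_0}$ and $g_{s_kw_0}$ exist for all $0\le q_1<\dots<q_n<1$, the function $g_{w_0}$ is $k$ times continuously differentiable on this domain, and at each of its points $$g_{s_kw_0}=\left(\frac{1}{k!}\,\frac{\partial^k}{\partial q_{n-k+1}\cdots\partial q_n}-1\right)g_{w_0}.$$ -/

import Mathlib

namespace TASEP

/-- Discrete multiline queues of type `(1, …, 1)` (with `n` ones) on a ring of `N` sites:
`n` rows of boxes, the row with index `i` (counted from the top, starting at `0`)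
holding exactly `i + 1` boxes. -/
def MLQ (n N : ℕ) : Type :=
  {row : Fin n → Finset (Fin N) // ∀ i, (row i).card = i.val + 1}

/-- `M.IsLabelling pos`: the labelling procedure, run on `M`, puts label `j` of row `i` on the box
in column `pos i j`. Labels start at `0`, so that row `i` carries the labels `0, …, i`, each once.
Going down from row `i` to the next row `i'`, the labels `j = 0, …, i` are treated in increasing
order, and `j` is put on the first box of row `i'`, weakly to the right (cyclically) of column
`pos i j`, that has not received one of the labels `j' < j`; the box that is left over receives
the new label `i + 1`. Subtraction in `Fin N` is modulo `N`, so `c - d` is the number of steps to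
the right that lead from column `d` to column `c` on the ring. -/
def MLQ.IsLabelling {n N : ℕ} (M : MLQ n N) (pos : (i : Fin n) → Fin (i.val + 1) → Fin N) : Prop :=
  (∀ i, Function.Injective (pos i) ∧ Set.range (pos i) = (M.1 i : Set (Fin N))) ∧
  ∀ (i : Fin n) (h : i.val + 1 < n) (j : Fin (i.val + 1)),
    ∀ c ∈ M.1 ⟨i.val + 1, h⟩,
      (∀ j' < j, pos ⟨i.val + 1, h⟩ j'.castSucc ≠ c) →
        pos ⟨i.val + 1, h⟩ j.castSucc - pos i j ≤ c - pos i j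

/-- `count π b N` is `G_π(b₁, …, bₙ; N)`: the number of discrete multiline queues on `N` sites
whose bottom row (the row `i` with `i + 1 = n`) carries the label `π a` in column `b a`,
for every `a`. -/
noncomputable def count {n : ℕ} (π : Equiv.Perm (Fin n)) (b : Fin n → ℕ) (N : ℕ) : ℕ :=
  Nat.card {M : MLQ n N // ∃ pos, M.IsLabelling pos ∧
    ∀ (i : Fin n) (h : i.val + 1 = n) (a : Fin n), (pos i (Fin.cast h.symm (π a))).val = b a}

/-- `Z_N = ∏_{i = 1}^{n} (N choose i)`, the number of all discrete multiline queues. -/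
def total (n N : ℕ) : ℕ := ∏ i ∈ Finset.Icc 1 n, N.choose i

/-- The rescaled probability of labels `π` at the columns `⌊N q₁⌋, …, ⌊N qₙ⌋`. The factor `N ^ n`
is the inverse volume of a lattice cell, which turns probabilities into densities. -/
noncomputable def scaledProb {n : ℕ} (π : Equiv.Perm (Fin n)) (q : Fin n → ℝ) (N : ℕ) : ℝ :=
  (N : ℝ) ^ n * ((count π (fun a => ⌊(N : ℝ) * q a⌋₊) N : ℝ) / (total n N : ℝ))

/-- The continuous density `g_π(q₁, …, qₙ)`. -/
noncomputable def density {n : ℕ} (π : Equiv.Perm (Fin n)) (q : Fin n → ℝ) : ℝ :=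
  Filter.limUnder Filter.atTop (scaledProb π q)

/-- The domain `0 ≤ q₁ < ⋯ < qₙ < 1`. -/
def domain (n : ℕ) : Set (Fin n → ℝ) :=
  {q | StrictMono q ∧ ∀ a, 0 ≤ q a ∧ q a < 1}

/-- The partial derivative `∂f/∂q_a`. -/
noncomputable def partialDeriv {n : ℕ} (a : Fin n) (f : (Fin n → ℝ) → ℝ) (q : Fin n → ℝ) : ℝ :=
  deriv (fun t => f (Function.update q a t)) (q a)

/-- The mixed derivative `∂^k f / ∂q_{n-k+1} ⋯ ∂q_n` in the last `k` variables, one in each. -/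
noncomputable def lastPartials {n : ℕ} (k : ℕ) (f : (Fin n → ℝ) → ℝ) : (Fin n → ℝ) → ℝ :=
  ((List.finRange n).drop (n - k)).foldr partialDeriv f

/-- The reverse permutation `w₀ = n (n-1) ⋯ 1`. -/
def w0 (n : ℕ) : Equiv.Perm (Fin n) := Fin.revPerm

/-- `s_k w₀ = n ⋯ (k+2) k (k+1) (k-1) ⋯ 1`: the letters `k` and `k+1`, which are the elements
`k-1` and `k` of `Fin n`, are interchanged in the word `w₀`. -/
def skw0 (n k : ℕ) (hkn : k < n) : Equiv.Perm (Fin n) :=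
  Equiv.swap ⟨k - 1, by omega⟩ ⟨k, hkn⟩ * w0 n

end TASEP

namespace TASEP

open Finset Filter Topology

/-! `weight` counts queues by their labelled bottom row `p`, as a sum over the labelled rows `q`
above with `Step q p`. Columns are indexed by label, so the word `w0` means that `p` is decreasing.
In that case `Step q p` says that `q` interlaces `p`, so `q` is decreasing too. The count is thus an
iterated sum over interlacing rows, and multilinearity makes it a determinant of rising factorials
(`weight_of_strictAnti`).

Now interchange the labels `a` and `a + 1`, where `a = k - 1` because labels start at zero. A row
above is either decreasing, or decreasing after the same interchange, or has two equal columns and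
weight zero. Induction on the number of rows, with the cancellation in `sum_swapBox`, gives
`weight_swap`: the count is `N.choose k * phiDet n k - phiDet n 0`, where `phiDet n k` has its first
`k` rows lowered by one order. The induction works because `phiDet n k` satisfies a recursion over
the very domain that survives the cancellation (`phiDet_succ_eq_sum`). It starts at `k + 1` labels,
where one column above becomes free; only this start is restricted to `k = 1, 2`.

After rescaling, rising factorials become monomials `x ^ d / d!`, lowering a row becomes
differentiation in its variable, and `N.choose k` becomes `1 / k!`. Label `j` sits at the variable
`q j.rev`, so the first `k` rows belong to the last `k` variables. -/

/-! ### Labelled rows and the row-by-row recursion -/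

/-- The labelled row `q` induces the labelled row `p` below it. -/
def Step {n N : ℕ} (q : Fin (n + 1) → Fin N) (p : Fin (n + 2) → Fin N) : Prop :=
  Function.Injective p ∧ ∀ j : Fin (n + 1), ∀ c ∈ Set.range p,
    (∀ j' < j, p j'.castSucc ≠ c) → p j.castSucc - q j ≤ c - q j

/-- The labelling procedure puts label `j` of the bottom row in column `p j`. -/
def MLQ.Bottom {n N : ℕ} (M : MLQ (n + 1) N) (p : Fin (n + 1) → Fin N) : Prop :=
  ∃ pos, M.IsLabelling pos ∧ pos (Fin.last n) = p

/-- Remove the bottom row. -/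
def MLQ.pop {n N : ℕ} (M : MLQ (n + 1) N) : MLQ n N :=
  ⟨fun i => M.1 i.castSucc, fun i => M.2 i.castSucc⟩

/-- Add a bottom row. -/
def MLQ.push {n N : ℕ} (M : MLQ n N) (s : Finset (Fin N)) (hs : s.card = n + 1) :
    MLQ (n + 1) N :=
  ⟨Fin.lastCases s M.1, fun i => by
    refine Fin.lastCases ?_ (fun i => ?_) i
    · simpa using hs
    · simpa using M.2 i⟩

lemma MLQ.pop_push {n N : ℕ} (M : MLQ n N) (s : Finset (Fin N)) (hs : s.card = n + 1) :
    (M.push s hs).pop = M := by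
  apply Subtype.ext
  funext i
  simp [MLQ.pop, MLQ.push]

lemma MLQ.push_last {n N : ℕ} (M : MLQ n N) (s : Finset (Fin N)) (hs : s.card = n + 1) :
    (M.push s hs).1 (Fin.last n) = s := by
  simp [MLQ.push]

lemma MLQ.ext_pop {n N : ℕ} {M M' : MLQ (n + 1) N} (h : M.pop = M'.pop)
    (h' : M.1 (Fin.last n) = M'.1 (Fin.last n)) : M = M' := by
  apply Subtype.ext
  funext i
  refine Fin.lastCases h' (fun i => ?_) i
  exact congrFun (congrArg Subtype.val h) i

lemma MLQ.bottom_zero {N : ℕ} (M : MLQ 1 N) (p : Fin 1 → Fin N) :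
    M.Bottom p ↔ (M.1 0 : Set (Fin N)) = Set.range p := by
  constructor
  · rintro ⟨pos, h, rfl⟩
    exact (h.1 0).2.symm
  · intro h
    refine ⟨fun i j => p ⟨j.val, by omega⟩, ⟨fun i => ?_, fun i hi => by omega⟩, rfl⟩
    obtain rfl : i = 0 := by ext; omega
    exact ⟨fun a b _ => by ext; omega, h.symm⟩

lemma MLQ.bottom_succ {n N : ℕ} (M : MLQ (n + 2) N) (p : Fin (n + 2) → Fin N) :
    M.Bottom p ↔ (M.1 (Fin.last _) : Set (Fin N)) = Set.range p ∧
      ∃ q, M.pop.Bottom q ∧ Step q p := by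
  constructor
  · rintro ⟨pos, h, rfl⟩
    refine ⟨(h.1 _).2.symm, pos (Fin.last n).castSucc,
      ⟨fun i => pos i.castSucc, ⟨fun i => h.1 i.castSucc, fun i hi => ?_⟩, rfl⟩,
      (h.1 _).1, fun j c hc => ?_⟩
    · exact h.2 i.castSucc (by simp; omega)
    · have hc' : c ∈ M.1 (Fin.last (n + 1)) := by
        rw [(h.1 _).2] at hc
        exact hc
      exact h.2 (Fin.last n).castSucc (by simp) j c hc'
  · rintro ⟨hr, q, ⟨pos, h, rfl⟩, hs⟩
    let pos' : (i : Fin (n + 2)) → Fin (i.val + 1) → Fin N :=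
      Fin.lastCases (motive := fun i => Fin (i.val + 1) → Fin N) p (fun i => pos i)
    have e1 : pos' (Fin.last _) = p := by simp [pos']
    have e2 : ∀ i : Fin (n + 1), pos' i.castSucc = pos i := fun i => by simp [pos']
    refine ⟨pos', ⟨fun i => ?_, fun i hi => ?_⟩, e1⟩
    · refine Fin.lastCases ?_ (fun i => ?_) i
      · rw [e1]
        exact ⟨hs.1, hr.symm⟩
      · rw [e2]
        exact h.1 i
    · obtain ⟨i, rfl⟩ : ∃ i' : Fin (n + 1), i = i'.castSucc := ⟨⟨i.val, by omega⟩, rfl⟩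
      by_cases hi' : i.val + 1 < n + 1
      · have := h.2 i hi'
        have e3 := e2 ⟨i.val + 1, hi'⟩
        have e4 := e2 i
        intro j c hc
        have := this j c hc
        rw [← e3, ← e4] at this
        exact this
      · obtain rfl : i = Fin.last n := by ext; simp; omega
        intro j c hc
        have hc' : c ∈ Set.range p := by
          rw [← hr]
          exact hc
        have := hs.2 j c hc'
        rw [← e1, ← e2] at this
        exact this

/-- By induction on the label: once the smaller labels agree, the column chosen by either word is
still vacant for the other, so each is at most as far away as the other. The leftover label is then
forced. -/
lemma Step.unique {n N : ℕ} {q : Fin (n + 1) → Fin N} {p p' : Fin (n + 2) → Fin N}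
    (h : Step q p) (h' : Step q p') (hr : Set.range p = Set.range p') : p = p' := by
  have key : ∀ m : ℕ, ∀ j : Fin (n + 1), j.val = m → p j.castSucc = p' j.castSucc := by
    intro m
    induction m using Nat.strong_induction_on with
    | _ m ih =>
      intro j hj
      have a1 : p j.castSucc - q j ≤ p' j.castSucc - q j := by
        refine h.2 j _ (hr ▸ Set.mem_range_self _) fun j' hj' => ?_
        rw [ih j'.val (by omega) j' rfl]
        intro e
        have := Fin.castSucc_injective _ (h'.1 e)
        omega
      have a2 : p' j.castSucc - q j ≤ p j.castSucc - q j := by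
        refine h'.2 j _ (hr ▸ Set.mem_range_self _) fun j' hj' => ?_
        rw [← ih j'.val (by omega) j' rfl]
        intro e
        have := Fin.castSucc_injective _ (h.1 e)
        omega
      have : NeZero N := ⟨by rintro rfl; exact (q 0).elim0⟩
      exact sub_left_injective (le_antisymm a1 a2)
  funext j
  refine Fin.lastCases ?_ (fun j => key _ j rfl) j
  have : p (Fin.last _) ∈ Set.range p' := hr ▸ Set.mem_range_self _
  obtain ⟨i, hi⟩ := this
  revert hi
  refine Fin.lastCases (fun e => e.symm) (fun i e => ?_) i
  rw [← key _ i rfl] at e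
  exact absurd (h.1 e) (Fin.castSucc_lt_last i).ne

lemma MLQ.Bottom.range_eq {n N : ℕ} {M : MLQ (n + 1) N} {p : Fin (n + 1) → Fin N}
    (h : M.Bottom p) : (M.1 (Fin.last n) : Set (Fin N)) = Set.range p := by
  obtain ⟨pos, h, rfl⟩ := h
  exact (h.1 _).2.symm

lemma MLQ.Bottom.unique {n N : ℕ} {M : MLQ (n + 1) N} {p p' : Fin (n + 1) → Fin N}
    (h : M.Bottom p) (h' : M.Bottom p') : p = p' := by
  induction n with
  | zero =>
    have hr := h.range_eq.symm.trans h'.range_eq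
    funext i
    obtain ⟨j, hj⟩ : p i ∈ Set.range p' := hr ▸ Set.mem_range_self _
    rw [← hj, show i = j by ext; omega]
  | succ n ih =>
    have hr := h.range_eq.symm.trans h'.range_eq
    obtain ⟨-, q, hq, hs⟩ := (M.bottom_succ p).1 h
    obtain ⟨-, q', hq', hs'⟩ := (M.bottom_succ p').1 h'
    obtain rfl := ih hq hq'
    exact hs.unique hs' hr

instance (n N : ℕ) : Finite (MLQ n N) := by unfold MLQ; infer_instance

open Classical in
/-- The number of multiline queues whose bottom row has label `j` in column `p j`. -/
noncomputable def weight {N : ℕ} : (n : ℕ) → (Fin (n + 1) → Fin N) → ℕ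
  | 0, _ => 1
  | n + 1, p => ∑ q with Step q p, weight n q

/-- Queues are fibred over the labelled row just above the bottom. Uniqueness of the labelling
ensures that no queue is counted in two fibres. -/
lemma card_bottom {N : ℕ} (n : ℕ) (p : Fin (n + 1) → Fin N) :
    Nat.card {M : MLQ (n + 1) N // M.Bottom p} = weight n p := by
  classical
  induction n with
  | zero =>
    rw [weight, Nat.card_eq_one_iff_unique]
    constructor
    · refine ⟨fun ⟨M, h⟩ ⟨M', h'⟩ => Subtype.ext (MLQ.ext_pop ?_ ?_)⟩
      · exact Subtype.ext (funext fun i => i.elim0)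
      · exact Finset.coe_injective (h.range_eq.trans h'.range_eq.symm)
    · refine ⟨⟨⟨fun i => {p i}, fun i => by simp⟩, (MLQ.bottom_zero _ _).2 ?_⟩⟩
      rw [Set.range_unique]
      simp
  | succ n ih =>
    rw [weight, ← Finset.sum_congr rfl fun q _ => ih q,
      Finset.sum_subtype (p := fun q => Step q p) _ (by simp), ← Nat.card_sigma]
    symm
    have hc : ∀ q : {q // Step q p}, (univ.image p).card = n + 1 + 1 := fun q => by
      rw [Finset.card_image_of_injective _ q.2.1]
      simp
    refine Nat.card_congr (Equiv.ofBijective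
      (fun x => ⟨x.2.1.push (univ.image p) (hc x.1), ?_⟩) ⟨?_, ?_⟩)
    · rw [MLQ.bottom_succ, MLQ.push_last, MLQ.pop_push]
      exact ⟨by simp, x.1.1, x.2.2, x.1.2⟩
    · rintro ⟨⟨q, hq⟩, M, hM⟩ ⟨⟨q', hq'⟩, M', hM'⟩ h
      have h2 := congrArg (fun x => MLQ.pop x.1) h
      simp only [MLQ.pop_push] at h2
      subst h2
      obtain rfl := hM.unique hM'
      rfl
    · rintro ⟨M, hM⟩
      obtain ⟨hr, q, hq, hs⟩ := (M.bottom_succ p).1 hM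
      refine ⟨⟨⟨q, hs⟩, M.pop, hq⟩, Subtype.ext (MLQ.ext_pop (MLQ.pop_push _ _ (hc ⟨q, hs⟩)) ?_)⟩
      rw [MLQ.push_last]
      apply Finset.coe_injective
      rw [hr]
      simp

lemma count_eq_weight {n N : ℕ} (π : Equiv.Perm (Fin (n + 1))) (p : Fin (n + 1) → Fin N) :
    count π (fun a => (p (π a)).val) N = weight n p := by
  rw [← card_bottom, count]
  refine Nat.card_congr (Equiv.subtypeEquivRight fun M => exists_congr fun pos =>
    and_congr_right fun _ => ?_)
  constructor
  · intro h
    funext j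
    have := h (Fin.last n) rfl (π.symm j)
    simp only [Equiv.apply_symm_apply] at this
    exact Fin.ext this
  · rintro rfl i h a
    obtain rfl : i = Fin.last n := by ext; simp; omega
    rfl

/-! ### Cyclic distance and steps into a decreasing word -/

lemma val_sub_eq {N : ℕ} (x d : Fin N) :
    (x - d).val = if d ≤ x then x.val - d.val else N + x.val - d.val := by
  split_ifs with h
  · exact Fin.coe_sub_iff_le.2 h
  · exact Fin.coe_sub_iff_lt.2 (not_le.1 h)

/-- Going right from `d`, the larger of two distinct columns comes first exactly when `d` lies in
the half-open interval from the smaller to the larger. This replaces cyclic distances by linear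
inequalities. -/
lemma sub_le_sub_iff_cyclic {N : ℕ} (x y d : Fin N) :
    x - d ≤ y - d ↔ (y < x → y < d ∧ d ≤ x) ∧ (x < y → ¬ (x < d ∧ d ≤ y)) := by
  rw [Fin.le_def, val_sub_eq, val_sub_eq]
  simp only [Fin.le_def, Fin.lt_def]
  have := x.2
  have := y.2
  have := d.2
  split_ifs <;> omega

/-- The boxes still vacant for label `j` are those that end up with a label at least `j`. -/
lemma step_iff {n N : ℕ} (q : Fin (n + 1) → Fin N) (p : Fin (n + 2) → Fin N) :
    Step q p ↔ Function.Injective p ∧ ∀ j : Fin (n + 1), ∀ m, j.castSucc < m →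
      p j.castSucc - q j ≤ p m - q j := by
  refine and_congr_right fun hp => forall_congr' fun j => ?_
  constructor
  · intro h m hm
    refine h _ (Set.mem_range_self m) fun j' hj' e => ?_
    rw [← hp e, Fin.castSucc_lt_castSucc_iff] at hm
    exact lt_asymm hm hj'
  · rintro h _ ⟨m, rfl⟩ hm
    rcases lt_trichotomy m j.castSucc with h' | rfl | h'
    · exact absurd rfl (hm ⟨m.val, by simp [Fin.lt_def] at h'; omega⟩ h')
    · exact le_rfl
    · exact h m h'

/-- The competitor `j + 1` gives the strongest condition; larger labels lie further left and add
nothing. -/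
lemma step_iff_of_strictAnti {n N : ℕ} (q : Fin (n + 1) → Fin N) {p : Fin (n + 2) → Fin N}
    (hp : StrictAnti p) : Step q p ↔ ∀ j, q j ∈ Ioc (p j.succ) (p j.castSucc) := by
  simp only [step_iff, hp.injective, true_and, mem_Ioc, sub_le_sub_iff_cyclic]
  refine forall_congr' fun j => ⟨fun h => ?_, fun h m hm => ⟨fun _ => ⟨?_, h.2⟩, fun h' => ?_⟩⟩
  · exact (h j.succ Fin.castSucc_lt_succ).1 (hp Fin.castSucc_lt_succ)
  · exact (hp.antitone (Fin.castSucc_lt_iff_succ_le.1 hm)).trans_lt h.1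
  · exact absurd (hp hm) h'.not_gt

lemma weight_succ {n N : ℕ} {p : Fin (n + 2) → Fin N} (A : Finset (Fin (n + 1) → Fin N))
    (h : ∀ q, Step q p ↔ q ∈ A) : weight (n + 1) p = ∑ q ∈ A, weight n q := by
  classical
  rw [weight]
  exact Finset.sum_congr (by ext q; simp [h]) fun _ _ => rfl

lemma weight_eq_zero {n N : ℕ} {p : Fin (n + 1) → Fin N} (hp : ¬ Function.Injective p) :
    weight n p = 0 := by
  cases n with
  | zero => exact absurd (fun a b _ => by ext; omega) hp
  | succ n =>
    rw [weight_succ ∅ fun q => ⟨fun h => absurd h.1 hp, fun h => by simp at h⟩, sum_empty]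

/-! ### Determinants of rising factorials -/

/-- `Phi (j + 1) x` is the rising factorial of `x` of order `j` divided by `j!`. -/
def Phi : ℕ → ℕ → ℝ
  | 0, _ => 0
  | j + 1, x => (Nat.multichoose x j : ℝ)

lemma Phi_one (x : ℕ) : Phi 1 x = 1 := by simp [Phi]

/-- Pascal's rule; the value zero at order zero extends it to the constant `Phi 1`. -/
lemma Phi_succ_succ (m x : ℕ) : Phi (m + 1) (x + 1) = Phi (m + 1) x + Phi m (x + 1) := by
  cases m with
  | zero => simp [Phi]
  | succ m => simp [Phi, Nat.multichoose_succ_succ]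

lemma sum_Phi (m : ℕ) {b c : ℕ} (h : b ≤ c) :
    ∑ x ∈ Ioc b c, Phi m x = Phi (m + 1) c - Phi (m + 1) b := by
  induction c, h using Nat.le_induction with
  | base => simp
  | succ c h ih =>
    rw [Finset.sum_Ioc_succ_top h, ih, Phi_succ_succ]
    ring

/-- The row vectors of the determinants below. -/
def phiRow (n s x : ℕ) : Fin (n + 1) → ℝ := fun i => Phi (n + 1 - i.val - s) x

/-- The determinant with the first `k` rows lowered by one order. -/
noncomputable def phiDet (n k : ℕ) (p : Fin (n + 1) → ℕ) : ℝ :=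
  Matrix.det (Matrix.of fun j => phiRow n (if j.val < k then 1 else 0) (p j))

lemma sum_phiRow (n : ℕ) {s N : ℕ} (hs : s ≤ 1) {b c : Fin N} (h : b ≤ c) :
    ∑ x ∈ Ioc b c, phiRow n s x.val = fun i => phiRow (n + 1) s c.val i.castSucc
      - phiRow (n + 1) s b.val i.castSucc := by
  funext i
  have e : n + 1 + 1 - i.val - s = n + 1 - i.val - s + 1 := by omega
  simp only [Finset.sum_apply, phiRow, Fin.val_castSucc, e]
  rw [← sum_Phi _ (show b.val ≤ c.val from h), ← Fin.map_valEmbedding_Ioc, Finset.sum_map]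
  rfl

lemma det_sum_rows {m : ℕ} {α R : Type*} [CommRing R] [DecidableEq α] (A : Fin m → Finset α)
    (g : Fin m → α → Fin m → R) :
    Matrix.det (Matrix.of fun j => ∑ x ∈ A j, g j x) =
      ∑ r ∈ Fintype.piFinset A, Matrix.det (Matrix.of fun j => g j (r j)) :=
  (Matrix.detRowAlternating (n := Fin m) (R := R)).toMultilinearMap.map_sum_finset g A

/-- Subtracting from each row a multiple of the next one, so that the last column is cleared. -/
lemma det_eq_det_row_sub {n : ℕ} {R : Type*} [CommRing R]
    (M : Matrix (Fin (n + 2)) (Fin (n + 2)) R) (δ : Fin (n + 1) → R)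
    (h : ∀ j : Fin (n + 1), M j.castSucc (Fin.last _) = δ j * M j.succ (Fin.last _))
    (hl : M (Fin.last _) (Fin.last _) = 1) :
    M.det = Matrix.det (Matrix.of fun j i : Fin (n + 1) =>
      M j.castSucc i.castSucc - δ j * M j.succ i.castSucc) := by
  let B : Matrix (Fin (n + 2)) (Fin (n + 2)) R :=
    Matrix.of fun j i => Fin.lastCases (motive := fun _ => R) (M (Fin.last _) i)
      (fun j => M j.castSucc i - δ j * M j.succ i) j
  have hB : M.det = B.det := by
    -- The row operation used next adds a multiple of the preceding row, whereas here the following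
    -- row is subtracted; reversing rows and columns together leaves the determinant unchanged.
    rw [← Matrix.det_submatrix_equiv_self Fin.revPerm M,
      ← Matrix.det_submatrix_equiv_self Fin.revPerm B]
    refine Matrix.det_eq_of_forall_row_eq_smul_add_pred (fun i => δ i.rev) (fun j => ?_)
      fun i j => ?_
    · simp [B, Fin.rev_zero]
    · simp [B, Fin.rev_succ, Fin.rev_castSucc]
  rw [hB, Matrix.det_succ_column B (Fin.last _), Fin.sum_univ_castSucc, Finset.sum_eq_zero]
  · have e : Matrix.submatrix B (Fin.last (n + 1)).succAbove (Fin.last (n + 1)).succAbove =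
        Matrix.of fun j i : Fin (n + 1) =>
          M j.castSucc i.castSucc - δ j * M j.succ i.castSucc := by
      ext j i
      simp [B]
    rw [e]
    simp [B, hl, ← two_mul]
  · intro j _
    simp [B, h]

/-- The last column is `0` on the lowered rows and `1` on the others. Subtracting the next row
therefore clears it, except that the last lowered row already ends in `0` and stays as it is. -/
lemma phiDet_succ (n k : ℕ) (hk : k ≤ n + 1) (p : Fin (n + 2) → ℕ) :
    phiDet (n + 1) k p = Matrix.det (Matrix.of fun (j i : Fin (n + 1)) =>
      phiRow (n + 1) (if j.val < k then 1 else 0) (p j.castSucc) i.castSucc -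
        (if j.val + 1 = k then 0 else 1) *
          phiRow (n + 1) (if j.val + 1 < k then 1 else 0) (p j.succ) i.castSucc) := by
  rw [phiDet, det_eq_det_row_sub _ fun j : Fin (n + 1) => if j.val + 1 = k then 0 else 1]
  · rfl
  · intro j
    have e : n + 1 + 1 - (n + 1) = 1 := by omega
    simp only [Matrix.of_apply, phiRow, Fin.val_castSucc, Fin.val_succ, Fin.val_last, e]
    rcases lt_trichotomy (j.val + 1) k with h | h | h
    · simp [h, h.ne, (Nat.lt_succ_self _).trans h, Phi]
    · simp [h, (Nat.lt_succ_self j.val).trans_eq h, Phi]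
    · simp [h.ne', h.not_gt, (show ¬ j.val < k by omega), Phi]
  · have e : n + 1 + 1 - (n + 1) = 1 := by omega
    simp [phiRow, e, hk.not_gt, Phi]

lemma phiDet_zero_eq_sum {n N : ℕ} {p : Fin (n + 2) → Fin N} (hp : StrictAnti p) :
    phiDet (n + 1) 0 (fun j => (p j).val) =
      ∑ r ∈ Fintype.piFinset fun j : Fin (n + 1) => Ioc (p j.succ) (p j.castSucc),
        phiDet n 0 (fun j => (r j).val) := by
  rw [phiDet_succ _ _ (by omega)]
  simp only [phiDet, not_lt_zero, if_false]
  rw [← det_sum_rows (fun j : Fin (n + 1) => Ioc (p j.succ) (p j.castSucc))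
    fun j x => phiRow n 0 x.val]
  congr 1
  ext j i
  rw [Matrix.of_apply, Matrix.of_apply, sum_phiRow n zero_le_one
    (hp (Fin.castSucc_lt_succ (i := j))).le]
  simp

lemma strictAnti_of_mem {n N : ℕ} {b : Fin (n + 2) → Fin N} {r : Fin (n + 1) → Fin N}
    (h : ∀ j : Fin (n + 1), r j ∈ Ioc (b j.succ) (b j.castSucc)) : StrictAnti r := by
  cases n with
  | zero => exact fun a b h => by omega
  | succ n =>
    rw [Fin.strictAnti_iff_succ_lt]
    intro j
    exact (mem_Ioc.1 (h j.succ)).2.trans_lt (mem_Ioc.1 (h j.castSucc)).1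

theorem weight_of_strictAnti {N : ℕ} (n : ℕ) {p : Fin (n + 1) → Fin N} (hp : StrictAnti p) :
    (weight n p : ℝ) = phiDet n 0 (fun j => (p j).val) := by
  induction n with
  | zero => simp [weight, phiDet, phiRow, Phi]
  | succ n ih =>
    rw [phiDet_zero_eq_sum hp, weight_succ _ fun q => (step_iff_of_strictAnti q hp).trans
      Fintype.mem_piFinset.symm, Nat.cast_sum]
    exact Finset.sum_congr rfl fun q hq => ih (strictAnti_of_mem (Fintype.mem_piFinset.1 hq))

/-! ### Steps into a word with two adjacent labels interchanged -/

/-- The transposition of the labels `a` and `a + 1`. -/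
def adjSwap (n a : ℕ) (h : a + 1 < n) : Equiv.Perm (Fin n) :=
  Equiv.swap ⟨a, by omega⟩ ⟨a + 1, h⟩

lemma adjSwap_val {n a : ℕ} (h : a + 1 < n) (x : Fin n) :
    (adjSwap n a h x).val = if x.val = a then a + 1 else if x.val = a + 1 then a else x.val := by
  rw [adjSwap, Equiv.swap_apply_def]
  simp only [Fin.ext_iff]
  split_ifs <;> rfl

lemma adjSwap_adjSwap {n a : ℕ} (h : a + 1 < n) (x : Fin n) :
    adjSwap n a h (adjSwap n a h x) = x := Equiv.swap_apply_self _ _ _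

lemma step_swap_iff_aux {n N a : ℕ} (h : a + 1 < n + 2) (q : Fin (n + 1) → Fin N)
    {b : Fin (n + 2) → Fin N} (hb : StrictAnti b) :
    Step q (b ∘ adjSwap _ a h) ↔ ∀ j : Fin (n + 1), ∀ m, j.castSucc < m →
      (adjSwap _ a h j.castSucc < adjSwap _ a h m →
        q j ∈ Ioc (b (adjSwap _ a h m)) (b (adjSwap _ a h j.castSucc))) ∧
      (adjSwap _ a h m < adjSwap _ a h j.castSucc →
        q j ∉ Ioc (b (adjSwap _ a h j.castSucc)) (b (adjSwap _ a h m))) := by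
  simp only [step_iff, hb.injective.comp (adjSwap _ a h).injective, true_and, mem_Ioc,
    sub_le_sub_iff_cyclic, Function.comp_apply, hb.lt_iff_gt]

/-- The columns that are possible for label `j` above a word with `a` and `a + 1` interchanged. -/
def swapBox {n N : ℕ} (a : ℕ) (h : a + 1 < n + 1) (b : Fin (n + 2) → Fin N) (j : Fin (n + 1)) :
    Finset (Fin N) :=
  Ioc (b (if j.val = a then ⟨a + 2, by omega⟩ else j.succ))
    (b (if j.val = a then j.succ else if j.val = a + 1 then ⟨a, by omega⟩ else j.castSucc))

lemma step_swap_iff {n N a : ℕ} (h : a + 1 < n + 1) (q : Fin (n + 1) → Fin N)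
    {b : Fin (n + 2) → Fin N} (hb : StrictAnti b) :
    Step q (b ∘ adjSwap _ a (by omega)) ↔ ∀ j, q j ∈ swapBox a h b j := by
  rw [step_swap_iff_aux _ _ hb]
  refine forall_congr' fun j => ?_
  have hj := j.2
  have e1 : adjSwap (n + 2) a (by omega) j.castSucc =
      if j.val = a then j.succ else if j.val = a + 1 then ⟨a, by omega⟩ else j.castSucc := by
    ext
    rw [adjSwap_val]
    simp only [Fin.val_castSucc]
    split_ifs with h1 <;> simp [h1]
  rw [e1, swapBox]
  constructor
  · intro H
    -- The competitor giving the sharpest lower bound: among the larger labels on the left of label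
    -- `j`, it is the nearest.
    let m : Fin (n + 2) := if j.val = a then ⟨a + 2, by omega⟩ else
      if j.val + 1 = a then ⟨a + 1, by omega⟩ else j.succ
    have hm : j.castSucc < m := by
      simp only [m, Fin.lt_def]
      split_ifs <;> simp <;> omega
    have e2 : adjSwap (n + 2) a (by omega) m =
        if j.val = a then ⟨a + 2, by omega⟩ else j.succ := by
      ext
      rw [adjSwap_val]
      simp only [m]
      split_ifs <;> simp at * <;> omega
    have := (H m hm).1
    rw [e2] at this
    refine this ?_
    rw [Fin.lt_def]
    split_ifs <;> simp <;> omega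
  · intro H m hm
    have e3 := adjSwap_val (n := n + 2) (a := a) (by omega) m
    rw [Fin.lt_def, Fin.val_castSucc] at hm
    constructor
    · intro h'
      refine Ioc_subset_Ioc (hb.antitone ?_) le_rfl H
      rw [Fin.lt_def] at h'
      rw [Fin.le_def, e3]
      rw [e3] at h'
      split_ifs at h' ⊢ <;> simp at * <;> omega
    · intro h' h2
      rw [Fin.lt_def, e3] at h'
      have hja : j.val = a := by
        split_ifs at h' <;> simp at * <;> omega
      -- Only the pair `a`, `a + 1` is out of order, and there `q j` would lie both above and weakly
      -- below `b j.succ`.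
      simp only [hja, if_true, mem_Ioc] at H h2
      exact absurd h2.1 H.2.not_gt

/-- Here `a` is the largest label of the upper row, so its only competitor is the new label. It just
has to avoid the interval from which the new label's box would be reached first. -/
lemma step_swap_iff_last {N a : ℕ} (q : Fin (a + 1) → Fin N)
    {b : Fin (a + 2) → Fin N} (hb : StrictAnti b) :
    Step q (b ∘ adjSwap _ a (by omega)) ↔
      (∀ j : Fin a, q j.castSucc ∈ Ioc (b j.succ.castSucc) (b j.castSucc.castSucc)) ∧
      q (Fin.last a) ∉ Ioc (b (Fin.last a).succ) (b (Fin.last a).castSucc) := by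
  rw [step_swap_iff_aux _ _ hb, Fin.forall_fin_succ']
  refine and_congr (forall_congr' fun j => ?_) ?_
  · have hj := j.2
    have e1 : adjSwap (a + 2) a (by omega) j.castSucc.castSucc = j.castSucc.castSucc := by
      ext
      rw [adjSwap_val]
      simp only [Fin.val_castSucc]
      split_ifs <;> omega
    rw [e1]
    constructor
    · intro H
      have := (H (adjSwap (a + 2) a (by omega) j.succ.castSucc) ?_).1
      · rw [adjSwap_adjSwap] at this
        exact this (by simp [Fin.lt_def])
      · rw [Fin.lt_def, adjSwap_val]
        simp only [Fin.val_castSucc, Fin.val_succ]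
        split_ifs <;> omega
    · intro H m hm
      have e3 := adjSwap_val (n := a + 2) (a := a) (by omega) m
      have := m.2
      rw [Fin.lt_def, Fin.val_castSucc, Fin.val_castSucc] at hm
      constructor
      · intro h'
        refine Ioc_subset_Ioc (hb.antitone ?_) le_rfl H
        rw [Fin.le_def, e3]
        simp only [Fin.val_castSucc, Fin.val_succ]
        split_ifs <;> omega
      · intro h'
        rw [Fin.lt_def, e3] at h'
        simp only [Fin.val_castSucc] at h'
        split_ifs at h' <;> omega
  · have e1 : adjSwap (a + 2) a (by omega) (Fin.last a).castSucc = (Fin.last a).succ := by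
      ext
      rw [adjSwap_val]
      simp
    have e2 : adjSwap (a + 2) a (by omega) (Fin.last a).succ = (Fin.last a).castSucc := by
      ext
      rw [adjSwap_val]
      simp
    constructor
    · intro H
      have := (H (Fin.last a).succ Fin.castSucc_lt_succ).2
      rw [e1, e2] at this
      exact this Fin.castSucc_lt_succ
    · intro H m hm
      obtain rfl : m = (Fin.last a).succ := by
        rw [Fin.lt_def] at hm
        ext
        simp at hm ⊢
        omega
      rw [e1, e2]
      exact ⟨fun h' => absurd h' Fin.castSucc_lt_succ.not_gt, fun _ => H⟩

/-- The domain of summation that expresses `phiDet (n + 1) (a + 1)` by `phiDet n (a + 1)`. -/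
def shiftedBox {n N : ℕ} (a : ℕ) (h : a + 1 < n + 1) (b : Fin (n + 2) → Fin N) :
    Finset (Fin (n + 1) → Fin N) :=
  univ.filter fun r => (∀ j : Fin (n + 1), j.val ≠ a → r j ∈ Ioc (b j.succ) (b j.castSucc)) ∧
    r ⟨a, by omega⟩ ∈ Ioc (r ⟨a + 1, h⟩) (b ⟨a, by omega⟩)

/-- In `phiDet_succ` every row except row `a` is a difference, hence a sum over an interval. Row `a`
is a single vector at `b a`, not lowered; subtracting row `a + 1` from it turns it into a sum of
lowered rows from `r (a + 1)` to `b a`. This explains the dependent interval in `shiftedBox`. -/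
lemma phiDet_succ_eq_sum {n N a : ℕ} (h : a + 1 < n + 1) {b : Fin (n + 2) → Fin N}
    (hb : StrictAnti b) :
    phiDet (n + 1) (a + 1) (fun j => (b j).val) =
      ∑ r ∈ shiftedBox a h b, phiDet n (a + 1) (fun j => (r j).val) := by
  let i0 : Fin (n + 1) := ⟨a, by omega⟩
  let i1 : Fin (n + 1) := ⟨a + 1, h⟩
  let A : Fin (n + 1) → Finset (Fin N) := fun j =>
    if j = i0 then {b j.castSucc} else Ioc (b j.succ) (b j.castSucc)
  let g : Fin (n + 1) → Fin N → Fin (n + 1) → ℝ := fun j x =>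
    phiRow n (if j.val < a then 1 else 0) x.val
  have e0 : ∀ i : Fin (n + 1), n + 1 + 1 - i.val - 1 = n + 1 - i.val := fun i => by omega
  have h1 : phiDet (n + 1) (a + 1) (fun j => (b j).val) =
      ∑ r ∈ Fintype.piFinset A, Matrix.det (Matrix.of fun j => g j (r j)) := by
    rw [phiDet_succ _ _ (by omega), ← det_sum_rows]
    congr 1
    ext j i
    rw [Matrix.of_apply, Matrix.of_apply]
    by_cases hj : j = i0
    · subst hj
      simp [A, g, i0, phiRow, e0]
    · have hj' : j.val ≠ a := fun e => hj (Fin.ext e)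
      simp only [A, hj, if_false, g]
      rw [sum_phiRow n (by split_ifs <;> simp) (hb (Fin.castSucc_lt_succ (i := j))).le]
      have e1 : (j.val < a + 1) ↔ j.val < a := by omega
      simp [hj', e1]
  have h2 : ∀ r ∈ Fintype.piFinset A, Matrix.det (Matrix.of fun j => g j (r j)) =
      ∑ x ∈ Ioc (r i1) (r i0), phiDet n (a + 1) (fun j => (Function.update r i0 x j).val) := by
    intro r hr
    rw [Fintype.mem_piFinset] at hr
    have r0 : r i0 = b i0.castSucc := by simpa [A] using hr i0
    have r1 : r i1 ≤ b i1.castSucc := by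
      have := hr i1
      simp only [A, i0, i1, Fin.mk.injEq, Nat.succ_ne_self, if_false, mem_Ioc] at this
      exact this.2
    have hle : r i1 ≤ r i0 := by
      rw [r0]
      exact r1.trans (hb.antitone (by simp [i0, i1, Fin.le_def]))
    set M : Matrix (Fin (n + 1)) (Fin (n + 1)) ℝ := Matrix.of fun j => g j (r j) with hM
    have e1 : ∀ x, phiDet n (a + 1) (fun j => (Function.update r i0 x j).val) =
        Matrix.det (Matrix.updateRow M i0 (phiRow n 1 x.val)) := by
      intro x
      rw [phiDet]
      refine congrArg Matrix.det ?_
      ext j i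
      by_cases hj : j = i0
      · subst hj
        rw [Matrix.updateRow_self]
        simp [i0]
      · have hj' : j.val ≠ a := fun e => hj (Fin.ext e)
        have e1 : (j.val < a + 1) ↔ j.val < a := by omega
        rw [Matrix.updateRow_ne hj, Matrix.of_apply, Function.update_of_ne hj, if_congr e1 rfl rfl]
        rfl
    have e2 : ∑ x ∈ Ioc (r i1) (r i0), phiRow n 1 x.val = M i0 + (-1 : ℝ) • M i1 := by
      rw [sum_phiRow n le_rfl hle]
      ext i
      simp [hM, g, i0, i1, phiRow, sub_eq_add_neg, e0]
    rw [Finset.sum_congr rfl fun x _ => e1 x]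
    have e3 := (Matrix.detRowAlternating (n := Fin (n + 1)) (R := ℝ)).toMultilinearMap.map_update_sum
      (Ioc (r i1) (r i0)) i0 (fun x => phiRow n 1 x.val) M
    refine Eq.trans ?_ e3
    rw [e2]
    exact (Matrix.det_updateRow_add_smul_self M (by simp [i0, i1]) (-1)).symm
  rw [h1, Finset.sum_congr rfl h2, Finset.sum_sigma']
  -- The frozen coordinate `b a` of `r` carries no information and is overwritten by the new
  -- variable `x`.
  refine Finset.sum_nbij' (fun x => Function.update x.1 i0 x.2)
    (fun t => ⟨Function.update t i0 (b i0.castSucc), t i0⟩) ?_ ?_ ?_ ?_ ?_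
  · rintro ⟨r, x⟩ hrx
    simp only [mem_sigma, Fintype.mem_piFinset] at hrx
    obtain ⟨hr, hx⟩ := hrx
    have r0 : r i0 = b i0.castSucc := by simpa [A] using hr i0
    simp only [shiftedBox, mem_filter, mem_univ, true_and]
    refine ⟨fun j hj => ?_, ?_⟩
    · have hj' : j ≠ i0 := fun e => hj (congrArg Fin.val e)
      simpa [A, hj'] using hr j
    · rw [r0] at hx
      simpa [i0, i1] using hx
  · intro t ht
    simp only [shiftedBox, mem_filter, mem_univ, true_and] at ht
    simp only [mem_sigma, Fintype.mem_piFinset]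
    refine ⟨fun j => ?_, ?_⟩
    · by_cases hj : j = i0
      · subst hj
        simp [A]
      · have hj' : j.val ≠ a := fun e => hj (Fin.ext e)
        simpa [A, hj] using ht.1 j hj'
    · simpa [i0, i1] using ht.2
  · rintro ⟨r, x⟩ hrx
    simp only [mem_sigma, Fintype.mem_piFinset] at hrx
    have r0 : r i0 = b i0.castSucc := by simpa [A] using hrx.1 i0
    simp [← r0]
  · intro t _
    simp
  · intro _ _
    rfl

/-! ### Start of the induction: the two largest labels interchanged -/

/-- The interval forbidden to the last label is exactly the one it occupies above the decreasing
word, so the two counts add up to a sum in which that label is unrestricted. -/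
lemma weight_swap_last {N a : ℕ} {b : Fin (a + 2) → Fin N} (hb : StrictAnti b) :
    (weight (a + 1) (b ∘ adjSwap _ a (by omega)) : ℝ) =
      (∑ q : Fin (a + 1) → Fin N with
        ∀ j : Fin a, q j.castSucc ∈ Ioc (b j.succ.castSucc) (b j.castSucc.castSucc), weight a q :)
      - phiDet (a + 1) 0 (fun j => (b j).val) := by
  rw [← weight_of_strictAnti _ hb, eq_sub_iff_add_eq,
    weight_succ _ fun q => (step_iff_of_strictAnti q hb).trans Fintype.mem_piFinset.symm,
    weight_succ (univ.filter fun q => (∀ j : Fin a, q j.castSucc ∈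
      Ioc (b j.succ.castSucc) (b j.castSucc.castSucc)) ∧
      q (Fin.last a) ∉ Ioc (b (Fin.last a).succ) (b (Fin.last a).castSucc)) fun q =>
        (step_swap_iff_last q hb).trans (by simp)]
  rw [← Nat.cast_add, add_comm]
  refine congrArg Nat.cast ?_
  have := Finset.sum_filter_add_sum_filter_not (univ.filter fun q : Fin (a + 1) → Fin N =>
    ∀ j : Fin a, q j.castSucc ∈ Ioc (b j.succ.castSucc) (b j.castSucc.castSucc))
    (fun q => q (Fin.last a) ∈ Ioc (b (Fin.last a).succ) (b (Fin.last a).castSucc)) (weight a)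
  rw [filter_filter, filter_filter] at this
  rw [← this]
  congr 2
  ext q
  simp only [Fintype.mem_piFinset, mem_filter, mem_univ, true_and, Fin.forall_fin_succ',
    Fin.succ_castSucc]

lemma Phi_two (x : ℕ) : Phi 2 x = x := by simp [Phi]

lemma weight_swap_zero {N : ℕ} {b : Fin 2 → Fin N} (hb : StrictAnti b) :
    (weight 1 (b ∘ adjSwap 2 0 (by omega)) : ℝ) = N - phiDet 1 0 (fun j => (b j).val) := by
  rw [weight_swap_last hb]
  congr 1
  simp [weight]

lemma phiDet_one_zero (p : Fin 2 → ℕ) : phiDet 1 0 p = p 0 - p 1 := by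
  simp [phiDet, Matrix.det_fin_two, phiRow, Phi_one, Phi_two]

lemma weight_one {N : ℕ} (q : Fin 2 → Fin N) : weight 1 q = (q 0 - q 1).val := by
  rw [← Nat.cast_inj (R := ℝ), val_sub_eq]
  rcases lt_trichotomy (q 0) (q 1) with h | h | h
  · have hb : StrictAnti (q ∘ adjSwap 2 0 (by omega)) := by
      rw [Fin.strictAnti_iff_succ_lt]
      intro i
      obtain rfl := Subsingleton.elim i 0
      simpa [adjSwap] using h
    -- An increasing pair is an interchanged decreasing pair, so the case `a = 0` applies.
    have e : q = (q ∘ adjSwap 2 0 (by omega)) ∘ adjSwap 2 0 (by omega) := by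
      funext x
      simp [adjSwap_adjSwap]
    rw [if_neg h.not_ge, e, weight_swap_zero hb, phiDet_one_zero, Nat.cast_sub (by simp; omega)]
    simp [adjSwap]
    ring
  · rw [weight_eq_zero fun hi => absurd (hi h) (by simp), if_pos h.ge, h]
    simp
  · have hb : StrictAnti q := by
      rw [Fin.strictAnti_iff_succ_lt]
      intro i
      obtain rfl := Subsingleton.elim i 0
      exact h
    rw [if_pos h.le, weight_of_strictAnti _ hb, phiDet_one_zero, Nat.cast_sub h.le]

lemma sum_val_sub (N : ℕ) (x : Fin N) : ∑ y : Fin N, (x - y).val = N.choose 2 := by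
  have : NeZero N := ⟨by rintro rfl; exact x.elim0⟩
  rw [← Equiv.sum_comp (Equiv.subLeft x)]
  simp only [Equiv.subLeft_apply, sub_sub_cancel]
  rw [Fin.sum_univ_eq_sum_range (fun y => y),
    Finset.sum_range_id, Nat.choose_two_right]

/-- The weight of a two-label row is a cyclic distance. Its sum over the free second column is
`N.choose 2` whatever the first column is, leaving the length of one interval. -/
lemma weight_swap_one {N : ℕ} {b : Fin 3 → Fin N} (hb : StrictAnti b) :
    (weight 2 (b ∘ adjSwap 3 1 (by omega)) : ℝ) =
      N.choose 2 * phiDet 2 2 (fun j => (b j).val) - phiDet 2 0 (fun j => (b j).val) := by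
  rw [weight_swap_last hb]
  congr 1
  have h01 : b 1 ≤ b 0 := hb.antitone (by simp)
  have e1 : phiDet 2 2 (fun j => (b j).val) = (b 0).val - (b 1).val := by
    simp [phiDet, Matrix.det_fin_three, phiRow, Phi]
  have e2 : (∑ q : Fin 2 → Fin N with
      ∀ j : Fin 1, q j.castSucc ∈ Ioc (b j.succ.castSucc) (b j.castSucc.castSucc), weight 1 q) =
      ∑ x ∈ Ioc (b 1) (b 0), ∑ y : Fin N, (x - y).val := by
    rw [← Finset.sum_product']
    refine Finset.sum_nbij' (fun q => (q 0, q 1)) (fun x => ![x.1, x.2]) ?_ ?_ ?_ ?_ ?_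
    · intro q hq
      simpa [Fin.forall_fin_one] using hq
    · intro q hq
      simpa [Fin.forall_fin_one] using hq
    · intro q _
      funext i
      fin_cases i <;> rfl
    · intro q _
      rfl
    · intro q _
      rw [weight_one]
  rw [e2, Finset.sum_congr rfl fun x _ => sum_val_sub N x, Finset.sum_const, e1, Fin.card_Ioc,
    smul_eq_mul, Nat.cast_mul, Nat.cast_sub h01]
  ring

/-! ### The induction step for the interchanged word -/

lemma strictAnti_of_mem_shiftedBox {n N a : ℕ} {h : a + 1 < n + 1} {b : Fin (n + 2) → Fin N}
    {r : Fin (n + 1) → Fin N} (hb : StrictAnti b) (hr : r ∈ shiftedBox a h b) : StrictAnti r := by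
  simp only [shiftedBox, mem_filter, mem_univ, true_and] at hr
  obtain ⟨n, rfl⟩ : ∃ m, n = m + 1 := ⟨n - 1, by omega⟩
  rw [Fin.strictAnti_iff_succ_lt]
  intro j
  by_cases h1 : j.val = a
  · subst h1
    exact (mem_Ioc.1 hr.2).1
  · have h2 := (mem_Ioc.1 (hr.1 j.castSucc h1)).1
    by_cases h3 : j.val + 1 = a
    · subst h3
      exact (mem_Ioc.1 hr.2).2.trans_lt h2
    · exact (mem_Ioc.1 (hr.1 j.succ h3)).2.trans_lt h2

lemma forall_fin_iff_of_adjacent {n a : ℕ} (h : a + 1 < n) (P : Fin n → Prop) :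
    (∀ j, P j) ↔ (∀ j : Fin n, j.val ≠ a → j.val ≠ a + 1 → P j) ∧
      P ⟨a, by omega⟩ ∧ P ⟨a + 1, h⟩ := by
  refine ⟨fun H => ⟨fun j _ _ => H j, H _, H _⟩, fun H j => ?_⟩
  by_cases h1 : j.val = a
  · subst h1
    exact H.2.1
  · by_cases h2 : j.val = a + 1
    · obtain rfl : j = ⟨a + 1, h⟩ := Fin.ext h2
      exact H.2.2
    · exact H.1 j h1 h2

/-- The sum over the words above one with `a` and `a + 1` interchanged, in terms of sums over
decreasing words. -/
lemma sum_swapBox {n N a : ℕ} (h : a + 1 < n + 1) {b : Fin (n + 2) → Fin N} (hb : StrictAnti b)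
    (f : (Fin (n + 1) → Fin N) → ℝ) (F E : (Fin (n + 1) → Fin N) → ℝ)
    (h0 : ∀ q, ¬ Function.Injective q → f q = 0)
    (h1 : ∀ q, StrictAnti q → f q = F q)
    (h2' : ∀ q, StrictAnti q → f (q ∘ adjSwap _ a h) = E q - F q) :
    ∑ q ∈ Fintype.piFinset (swapBox a h b), f q = ∑ q ∈ shiftedBox a h b, E q -
      ∑ q ∈ Fintype.piFinset fun j : Fin (n + 1) => Ioc (b j.succ) (b j.castSucc), F q := by
  let i0 : Fin (n + 1) := ⟨a, by omega⟩
  let i1 : Fin (n + 1) := ⟨a + 1, h⟩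
  let G : (Fin (n + 1) → Fin N) → Prop := fun q => ∀ j : Fin (n + 1), j.val ≠ a →
    j.val ≠ a + 1 → q j ∈ Ioc (b j.succ) (b j.castSucc)
  obtain ⟨b0, hb0⟩ : ∃ x, x = b ⟨a, by omega⟩ := ⟨_, rfl⟩
  obtain ⟨b1, hb1⟩ : ∃ x, x = b ⟨a + 1, by omega⟩ := ⟨_, rfl⟩
  obtain ⟨b2, hb2⟩ : ∃ x, x = b ⟨a + 2, by omega⟩ := ⟨_, rfl⟩
  have h10 : b1 < b0 := hb0 ▸ hb1 ▸ hb (by simp)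
  have h21 : b2 < b1 := hb2 ▸ hb1 ▸ hb (by simp)
  have mS : ∀ q, q ∈ Fintype.piFinset (swapBox a h b) ↔
      G q ∧ q i0 ∈ Ioc b2 b1 ∧ q i1 ∈ Ioc b2 b0 := by
    intro q
    rw [Fintype.mem_piFinset, forall_fin_iff_of_adjacent h, hb0, hb1, hb2]
    refine and_congr (forall_congr' fun j => forall_congr' fun h1 => forall_congr' fun h2 => ?_)
      (and_congr ?_ ?_)
    · simp [swapBox, h1, h2]
    · simp [swapBox, i0]
    · simp [swapBox, i1]
  have mI : ∀ q, q ∈ (Fintype.piFinset fun j : Fin (n + 1) => Ioc (b j.succ) (b j.castSucc)) ↔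
      G q ∧ q i0 ∈ Ioc b1 b0 ∧ q i1 ∈ Ioc b2 b1 := by
    intro q
    rw [Fintype.mem_piFinset, forall_fin_iff_of_adjacent h, hb0, hb1, hb2]
    rfl
  have mT : ∀ q, q ∈ shiftedBox a h b ↔ G q ∧ q i0 ∈ Ioc (q i1) b0 ∧ q i1 ∈ Ioc b2 b1 := by
    intro q
    rw [shiftedBox, mem_filter, forall_fin_iff_of_adjacent h, hb0, hb1, hb2]
    simp only [mem_univ, true_and, ne_eq, not_true_eq_false, false_imp_iff, Nat.succ_ne_self,
      not_false_eq_true, true_imp_iff]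
    constructor
    · rintro ⟨⟨h1, h2⟩, h3⟩
      exact ⟨fun j hj hj' => h1 j hj hj' hj, h3, h2⟩
    · rintro ⟨h1, h3, h2⟩
      exact ⟨⟨fun j hj hj' _ => h1 j hj hj', h2⟩, h3⟩
  have s0 : adjSwap _ a h i0 = i1 := Equiv.swap_apply_left _ _
  have s1 : adjSwap _ a h i1 = i0 := Equiv.swap_apply_right _ _
  have hG : ∀ q, G q → G (q ∘ adjSwap _ a h) := by
    intro q hq j h1 h2
    have : adjSwap _ a h j = j :=
      Equiv.swap_apply_of_ne_of_ne (fun e => h1 (congrArg Fin.val e))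
        (fun e => h2 (congrArg Fin.val e))
    rw [Function.comp_apply, this]
    exact hq j h1 h2
  have hss : ∀ q : Fin (n + 1) → Fin N, (q ∘ adjSwap _ a h) ∘ adjSwap _ a h = q := by
    intro q
    funext x
    simp [adjSwap_adjSwap]
  -- Decreasing rows of the swap box form the part of the shifted box with `q a ≤ b (a + 1)`.
  have p1 : ∑ q ∈ Fintype.piFinset (swapBox a h b) with q i1 < q i0, f q =
      ∑ q ∈ shiftedBox a h b with q i0 ≤ b1, F q := by
    have e : (Fintype.piFinset (swapBox a h b)).filter (fun q => q i1 < q i0) =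
        (shiftedBox a h b).filter fun q => q i0 ≤ b1 := by
      ext q
      rw [mem_filter, mem_filter, mS, mT]
      simp only [mem_Ioc]
      constructor
      · rintro ⟨⟨hq, h1, h2⟩, h3⟩
        exact ⟨⟨hq, ⟨h3, h1.2.trans h10.le⟩, h2.1, h3.le.trans h1.2⟩, h1.2⟩
      · rintro ⟨⟨hq, h1, h2⟩, h3⟩
        exact ⟨⟨hq, ⟨h2.1.trans h1.1, h3⟩, h2.1, h2.2.trans h10.le⟩, h1.1⟩
    rw [e]
    exact Finset.sum_congr rfl fun q hq =>
      h1 q (strictAnti_of_mem_shiftedBox hb (mem_filter.1 hq).1)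
  -- The rest of the shifted box is the interlacing box.
  have p2 : ∑ q ∈ shiftedBox a h b with ¬ q i0 ≤ b1, F q =
      ∑ q ∈ Fintype.piFinset fun j : Fin (n + 1) => Ioc (b j.succ) (b j.castSucc), F q := by
    refine Finset.sum_congr ?_ fun _ _ => rfl
    ext q
    rw [mem_filter, mI, mT]
    simp only [mem_Ioc, not_le]
    constructor
    · rintro ⟨⟨hq, h1, h2⟩, h3⟩
      exact ⟨hq, ⟨h3, h1.2⟩, h2⟩
    · rintro ⟨hq, h1, h2⟩
      exact ⟨⟨hq, ⟨h2.2.trans_lt h1.1, h1.2⟩, h2⟩, h1.1⟩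
  -- Rows with `q a = q (a + 1)` contribute zero; interchanging the two columns maps the remaining
  -- rows onto the whole shifted box. The `F` terms of `p1` then cancel, leaving minus those of
  -- `p2`.
  have p3 : ∑ q ∈ Fintype.piFinset (swapBox a h b) with ¬ q i1 < q i0, f q =
      ∑ q ∈ shiftedBox a h b, (E q - F q) := by
    have e : ∑ q ∈ (Fintype.piFinset (swapBox a h b)).filter (fun q => ¬ q i1 < q i0), f q =
        ∑ q ∈ (Fintype.piFinset (swapBox a h b)).filter (fun q => q i0 < q i1), f q := by
      symm
      refine Finset.sum_subset (fun q hq => ?_) fun q hq hq' => h0 q fun hi => ?_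
      · rw [mem_filter] at hq ⊢
        exact ⟨hq.1, hq.2.not_gt⟩
      · rw [mem_filter] at hq hq'
        have : q i0 = q i1 :=
          le_antisymm (not_lt.1 hq.2) (not_lt.1 fun h' => hq' ⟨hq.1, h'⟩)
        exact absurd (congrArg Fin.val (hi this)) (by simp [i0, i1])
    rw [e]
    refine Finset.sum_nbij' (fun q => q ∘ adjSwap _ a h) (fun q => q ∘ adjSwap _ a h)
      ?_ ?_ (fun q _ => hss q) (fun q _ => hss q) ?_
    · intro q hq
      rw [mem_filter, mS] at hq
      obtain ⟨⟨hq, h1, h2⟩, h3⟩ := hq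
      rw [mem_Ioc] at h1 h2
      rw [mT]
      refine ⟨hG q hq, ?_⟩
      simp only [Function.comp_apply, s0, s1, mem_Ioc]
      exact ⟨⟨h3, h2.2⟩, h1⟩
    · intro q hq
      rw [mT] at hq
      obtain ⟨hq, h1, h2⟩ := hq
      rw [mem_Ioc] at h1 h2
      rw [mem_filter, mS]
      refine ⟨⟨hG q hq, ?_⟩, ?_⟩
      · simp only [Function.comp_apply, s0, s1, mem_Ioc]
        exact ⟨h2, h2.1.trans h1.1, h1.2⟩
      · simp only [Function.comp_apply, s0, s1]
        exact h1.1
    · intro q hq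
      rw [mem_filter, mS] at hq
      obtain ⟨⟨hq, h1, h2⟩, h3⟩ := hq
      rw [mem_Ioc] at h1 h2
      have hT : q ∘ adjSwap _ a h ∈ shiftedBox a h b := by
        rw [mT]
        refine ⟨hG q hq, ?_⟩
        simp only [Function.comp_apply, s0, s1, mem_Ioc]
        exact ⟨⟨h3, h2.2⟩, h1⟩
      have := h2' _ (strictAnti_of_mem_shiftedBox hb hT)
      rwa [hss] at this
  rw [← Finset.sum_filter_add_sum_filter_not _ (fun q => q i1 < q i0), p1, p3,
    Finset.sum_sub_distrib, ← Finset.sum_filter_add_sum_filter_not (shiftedBox a h b)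
      (fun q => q i0 ≤ b1) F, p2]
  ring

theorem weight_swap {N a : ℕ} (ha : a = 0 ∨ a = 1) (n : ℕ) (h : a + 1 < n + 1)
    {b : Fin (n + 1) → Fin N} (hb : StrictAnti b) :
    (weight n (b ∘ adjSwap _ a h) : ℝ) = N.choose (a + 1) *
      phiDet n (a + 1) (fun j => (b j).val) - phiDet n 0 (fun j => (b j).val) := by
  induction n with
  | zero => omega
  | succ n ih =>
    by_cases hn : a + 1 < n + 1
    · rw [weight_succ _ fun q => (step_swap_iff hn q hb).trans Fintype.mem_piFinset.symm,
        Nat.cast_sum, sum_swapBox hn hb _ (fun q => phiDet n 0 (fun j => (q j).val))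
        (fun q => N.choose (a + 1) * phiDet n (a + 1) (fun j => (q j).val)),
        phiDet_succ_eq_sum hn hb, phiDet_zero_eq_sum hb, Finset.mul_sum]
      · intro q hq
        rw [weight_eq_zero hq, Nat.cast_zero]
      · exact fun q hq => weight_of_strictAnti n hq
      · exact fun q hq => ih hn hq
    -- Only this start of the induction depends on `a` being `0` or `1`.
    · obtain rfl : n = a := by omega
      rcases ha with rfl | rfl
      · rw [weight_swap_zero hb]
        simp [phiDet, Matrix.det_fin_two, phiRow, Phi]
      · exact weight_swap_one hb

/-! ### Scaling limits of the determinants -/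

/-- The scaling limit of `Phi`. -/
noncomputable def psi : ℕ → ℝ → ℝ
  | 0, _ => 0
  | d + 1, x => x ^ d / (d.factorial : ℝ)

/-- The scaling limit of `phiDet`. -/
noncomputable def psiDet (n k : ℕ) (p : Fin (n + 1) → ℝ) : ℝ :=
  Matrix.det (Matrix.of fun j i : Fin (n + 1) =>
    psi (n + 1 - i.val - if j.val < k then 1 else 0) (p j))

lemma tendsto_floor_mul_div (x : ℝ) (hx : 0 ≤ x) :
    Tendsto (fun N : ℕ => (⌊(N : ℝ) * x⌋₊ : ℝ) / N) atTop (𝓝 x) := by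
  have := (tendsto_nat_floor_mul_div_atTop hx).comp (tendsto_natCast_atTop_atTop (R := ℝ))
  simpa [Function.comp_def, mul_comm] using this

lemma tendsto_multichoose (d : ℕ) (x : ℝ) (hx : 0 ≤ x) :
    Tendsto (fun N : ℕ => (Nat.multichoose ⌊(N : ℝ) * x⌋₊ d : ℝ) / (N : ℝ) ^ d) atTop
      (𝓝 (x ^ d / d.factorial)) := by
  have e : ∀ N : ℕ, (Nat.multichoose ⌊(N : ℝ) * x⌋₊ d : ℝ) / (N : ℝ) ^ d =
      (∏ i ∈ range d, ((⌊(N : ℝ) * x⌋₊ : ℝ) / N + (i : ℝ) / N)) / d.factorial := by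
    intro N
    have h := Nat.ascFactorial_eq_factorial_mul_choose' ⌊(N : ℝ) * x⌋₊ d
    rw [← Nat.multichoose_eq, Nat.ascFactorial_eq_prod_range, ← Nat.cast_inj (R := ℝ)] at h
    push_cast at h
    have hd : (d.factorial : ℝ) ≠ 0 := by positivity
    simp only [← add_div]
    rw [Finset.prod_div_distrib, h, Finset.prod_const, Finset.card_range, div_right_comm,
      mul_div_cancel_left₀ _ hd]
  simp only [e]
  have := tendsto_finsetProd (range d) fun i _ =>
    (tendsto_floor_mul_div x hx).add (tendsto_const_div_atTop_nhds_zero_nat (i : ℝ))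
  simpa using this.div_const (d.factorial : ℝ)

lemma tendsto_choose_div (d : ℕ) :
    Tendsto (fun N : ℕ => (N.choose d : ℝ) / (N : ℝ) ^ d) atTop (𝓝 (1 / d.factorial)) := by
  have h : Tendsto (fun N : ℕ => (N : ℝ) * (N : ℝ)⁻¹) atTop (𝓝 1) := by
    refine tendsto_const_nhds.congr' ?_
    filter_upwards [eventually_gt_atTop 0] with N hN
    rw [mul_inv_cancel₀ (by exact_mod_cast hN.ne')]
  simpa [div_eq_mul_inv] using ProbabilityTheory.tendsto_choose_mul_pow_atTop d h

/-- Column `i` scales like `N ^ (n - i)`, and each of the `k` lowered rows loses one power of `N`;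
normalizing rows and columns accordingly makes every entry converge. -/
lemma tendsto_phiDet (n k : ℕ) (hk : k ≤ n + 1) (p : Fin (n + 1) → ℝ) (hp : ∀ j, 0 ≤ p j) :
    Tendsto (fun N : ℕ => (N : ℝ) ^ k * phiDet n k (fun j => ⌊(N : ℝ) * p j⌋₊) /
      ∏ i ∈ range (n + 1), (N : ℝ) ^ i) atTop (𝓝 (psiDet n k p)) := by
  have h1 : Tendsto (fun N : ℕ => Matrix.det (Matrix.of fun j i : Fin (n + 1) =>
      (N : ℝ) ^ (if j.val < k then 1 else 0) * (((N : ℝ) ^ (n - i.val))⁻¹ *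
        phiRow n (if j.val < k then 1 else 0) ⌊(N : ℝ) * p j⌋₊ i)))
      atTop (𝓝 (psiDet n k p)) := by
    refine ((continuous_id (X := Matrix (Fin (n + 1)) (Fin (n + 1)) ℝ)).matrix_det.tendsto _).comp
      (tendsto_pi_nhds.2 fun j => tendsto_pi_nhds.2 fun i => ?_)
    simp only [Matrix.of_apply, phiRow]
    obtain ⟨s, hs⟩ : ∃ s, s = if j.val < k then 1 else 0 := ⟨_, rfl⟩
    have hs1 : s ≤ 1 := by
      rw [hs]
      split_ifs <;> simp
    rw [← hs]
    rcases hd : n + 1 - i.val - s with _ | d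
    · simp [Phi, psi]
    · have e : n - i.val = d + s := by omega
      refine (tendsto_multichoose d (p j) (hp j)).congr' ?_
      filter_upwards [eventually_gt_atTop 0] with N hN
      have hN' : (N : ℝ) ≠ 0 := by exact_mod_cast hN.ne'
      simp only [Phi, e, pow_add]
      field_simp
  refine h1.congr fun N => ?_
  have h2 := Matrix.det_mul_column (fun j : Fin (n + 1) => (N : ℝ) ^ (if j.val < k then 1 else 0))
    (Matrix.of fun j i : Fin (n + 1) => (((N : ℝ) ^ (n - i.val))⁻¹ *
        phiRow n (if j.val < k then 1 else 0) ⌊(N : ℝ) * p j⌋₊ i))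
  have h3 := Matrix.det_mul_row (fun i : Fin (n + 1) => ((N : ℝ) ^ (n - i.val))⁻¹)
    (Matrix.of fun j => phiRow n (if j.val < k then 1 else 0) ⌊(N : ℝ) * p j⌋₊)
  have h4 : ∏ j : Fin (n + 1), (N : ℝ) ^ (if j.val < k then 1 else 0) = (N : ℝ) ^ k := by
    rw [Finset.prod_pow_eq_pow_sum, Fin.sum_univ_eq_sum_range (fun j => if j < k then 1 else 0),
      Finset.sum_boole]
    congr 1
    have : (range (n + 1)).filter (fun j => j < k) = range k := by
      ext j
      simp
      omega
    simp [this]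
  have h5 : ∏ i : Fin (n + 1), ((N : ℝ) ^ (n - i.val))⁻¹ =
      (∏ i ∈ range (n + 1), (N : ℝ) ^ i)⁻¹ := by
    rw [Fin.prod_univ_eq_prod_range (fun i => ((N : ℝ) ^ (n - i))⁻¹), Finset.prod_inv_distrib,
      ← Finset.prod_range_reflect (fun i => (N : ℝ) ^ i)]
    simp only [Nat.add_sub_cancel]
  refine h2.trans ?_
  rw [h4]
  refine (congrArg _ h3).trans ?_
  rw [h5, phiDet]
  ring

/-! ### Derivatives of the limiting determinant -/

lemma hasDerivAt_psi (d : ℕ) (x : ℝ) : HasDerivAt (psi (d + 1)) (psi d x) x := by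
  have e : ∀ d, psi (d + 1) = fun x => x ^ d / (d.factorial : ℝ) := fun d => rfl
  rw [e]
  cases d with
  | zero => simpa [psi] using hasDerivAt_const x (1 : ℝ)
  | succ d =>
    have := (hasDerivAt_pow (d + 1) x).div_const ((d + 1).factorial : ℝ)
    have e' : x ^ d / (d.factorial : ℝ) =
        ((d + 1 : ℕ) : ℝ) * x ^ (d + 1 - 1) / ((d + 1).factorial : ℝ) := by
      rw [Nat.factorial_succ, Nat.add_sub_cancel]
      push_cast
      field_simp
    exact this.congr_deriv e'.symm

/-- The variable `p l` occurs only in row `l`, and the determinant is linear in that row;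
differentiating the row lowers its order by one. -/
lemma hasDerivAt_psiDet (n l : ℕ) (hl : l < n + 1) (p : Fin (n + 1) → ℝ) :
    HasDerivAt (fun t => psiDet n l (Function.update p ⟨l, hl⟩ t)) (psiDet n (l + 1) p)
      (p ⟨l, hl⟩) := by
  let M : Matrix (Fin (n + 1)) (Fin (n + 1)) ℝ := Matrix.of fun j i : Fin (n + 1) =>
    psi (n + 1 - i.val - if j.val < l then 1 else 0) (p j)
  let D := LinearMap.toContinuousLinearMap
    ((Matrix.detRowAlternating (n := Fin (n + 1)) (R := ℝ)).toMultilinearMap.toLinearMap M ⟨l, hl⟩)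
  have hv : HasDerivAt (fun t => fun i : Fin (n + 1) => psi (n + 1 - i.val) t)
      (fun i => psi (n - i.val) (p ⟨l, hl⟩)) (p ⟨l, hl⟩) := by
    rw [hasDerivAt_pi]
    intro i
    have e : n + 1 - i.val = n - i.val + 1 := by omega
    rw [e]
    exact hasDerivAt_psi _ _
  have h := D.hasFDerivAt.comp_hasDerivAt (p ⟨l, hl⟩) hv
  have hD : ∀ v, D v = Matrix.det (Matrix.updateRow M ⟨l, hl⟩ v) := fun v => rfl
  have e1 : (fun t => psiDet n l (Function.update p ⟨l, hl⟩ t)) =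
      D ∘ fun t => fun i : Fin (n + 1) => psi (n + 1 - i.val) t := by
    funext t
    rw [Function.comp_apply, hD, psiDet]
    congr 1
    ext j i
    by_cases hj : j = ⟨l, hl⟩
    · subst hj
      rw [Matrix.updateRow_self]
      simp
    · rw [Matrix.updateRow_ne hj]
      simp [M, hj]
  have e2 : psiDet n (l + 1) p = D fun i => psi (n - i.val) (p ⟨l, hl⟩) := by
    rw [hD, psiDet]
    congr 1
    ext j i
    by_cases hj : j = ⟨l, hl⟩
    · subst hj
      have e : n + 1 - i.val - 1 = n - i.val := by omega
      rw [Matrix.updateRow_self]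
      simp [e]
    · have e : j.val < l + 1 ↔ j.val < l := by
        have : j.val ≠ l := fun e => hj (Fin.ext e)
        omega
      rw [Matrix.updateRow_ne hj]
      simp only [Matrix.of_apply, M, e]
  rw [e1, e2]
  exact h

lemma contDiff_psiDet (n l : ℕ) (r : WithTop ℕ∞) :
    ContDiff ℝ r (fun q : Fin (n + 1) → ℝ => psiDet n l fun j => q j.rev) := by
  have hpsi : ∀ d, ContDiff ℝ r (psi d) := by
    intro d
    cases d with
    | zero => exact contDiff_const
    | succ d => exact (contDiff_id.pow d).div_const _
  simp only [psiDet, Matrix.det_apply, Matrix.of_apply]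
  refine ContDiff.sum fun σ _ => ContDiff.const_smul _ (contDiff_prod fun i _ => ?_)
  exact (hpsi _).comp (contDiff_apply ℝ ℝ _)

/-- The domain is not open, since the first variable may vanish. The other variables are strictly
positive and can move in both directions. -/
lemma eventually_update_mem_domain {n : ℕ} {q : Fin n → ℝ} (hq : q ∈ domain n) (x : Fin n)
    (hx : 0 < x.val) : ∀ᶠ t in 𝓝 (q x), Function.update q x t ∈ domain n := by
  have hu : Continuous fun t => Function.update q x t := continuous_const.update x continuous_id
  have hc : ∀ i, Continuous fun t => Function.update q x t i := fun i =>
    (continuous_apply i).comp hu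
  have he : ∀ i, Function.update q x (q x) i = q i := fun i => by simp
  have h1 : ∀ᶠ t in 𝓝 (q x), ∀ i j, i < j →
      Function.update q x t i < Function.update q x t j := by
    rw [eventually_all]
    intro i
    rw [eventually_all]
    intro j
    by_cases hij : i < j
    · refine ((hc i).continuousAt.eventually_lt (hc j).continuousAt ?_).mono fun t ht _ => ht
      rw [he, he]
      exact hq.1 hij
    · exact Eventually.of_forall fun t h => absurd h hij
  have h2 : ∀ᶠ t in 𝓝 (q x), t < 1 := eventually_lt_nhds (hq.2 x).2
  have h3 : ∀ᶠ t in 𝓝 (q x), 0 < t := by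
    refine eventually_gt_nhds ((hq.2 ⟨0, by omega⟩).1.trans_lt (hq.1 ?_))
    exact hx
  filter_upwards [h1, h2, h3] with t ht1 ht2 ht3
  refine ⟨fun i j hij => ht1 i j hij, fun a => ?_⟩
  by_cases ha : a = x
  · subst ha
    simp [ht2, ht3.le]
  · simpa [ha] using hq.2 a

lemma partialDeriv_eq {n l : ℕ} (hl : l < n) (c : ℝ) (f : (Fin (n + 1) → ℝ) → ℝ)
    (hf : ∀ q ∈ domain (n + 1), f q = c * psiDet n l fun j => q j.rev)
    {q : Fin (n + 1) → ℝ} (hq : q ∈ domain (n + 1)) :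
    partialDeriv ⟨n - l, by omega⟩ f q = c * psiDet n (l + 1) fun j => q j.rev := by
  have hr : Fin.rev (⟨l, by omega⟩ : Fin (n + 1)) = ⟨n - l, by omega⟩ := by
    ext
    simp [Fin.val_rev]
  have h := (hasDerivAt_psiDet n l (by omega) fun j => q j.rev).const_mul c
  rw [hr] at h
  rw [partialDeriv]
  refine (h.congr_of_eventuallyEq ?_).deriv
  filter_upwards [eventually_update_mem_domain hq ⟨n - l, by omega⟩ (by simp; omega)] with t ht
  rw [hf _ ht]
  congr 2
  funext j
  by_cases hj : j = ⟨l, by omega⟩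
  · subst hj
    rw [hr]
    simp
  · have : j.rev ≠ ⟨n - l, by omega⟩ := fun e => hj (Fin.rev_injective (e.trans hr.symm))
    simp [hj, this]

/-- The fold differentiates in the last variable first, so the rows are lowered in the order `0, 1,
…`; `l ≤ n` keeps the first variable out. -/
lemma lastPartials_eq {n : ℕ} (c : ℝ) (f : (Fin (n + 1) → ℝ) → ℝ)
    (hf : ∀ q ∈ domain (n + 1), f q = c * psiDet n 0 fun j => q j.rev) (l : ℕ) (hl : l ≤ n) :
    ∀ q ∈ domain (n + 1), lastPartials l f q = c * psiDet n l fun j => q j.rev := by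
  induction l with
  | zero =>
    have e : (List.finRange (n + 1)).drop (n + 1) = [] := List.drop_eq_nil_of_le (by simp)
    simpa [lastPartials, e] using hf
  | succ l ih =>
    intro q hq
    have e : (List.finRange (n + 1)).drop (n + 1 - (l + 1)) =
        ⟨n - l, by omega⟩ :: (List.finRange (n + 1)).drop (n + 1 - l) := by
      rw [List.drop_eq_getElem_cons (by simp)]
      congr 1
      · ext
        simp
      · congr 1
        omega
    rw [lastPartials, e, List.foldr_cons]
    exact partialDeriv_eq (by omega) c _ (ih (by omega)) hq

/-! ### Limits of the rescaled probabilities -/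

lemma tendsto_total (n : ℕ) :
    Tendsto (fun N : ℕ => (∏ i ∈ Icc 1 n, (N : ℝ) ^ i) / (total n N : ℝ)) atTop
      (𝓝 (∏ i ∈ Icc 1 n, (i.factorial : ℝ))) := by
  have : ∀ N : ℕ, (∏ i ∈ Icc 1 n, (N : ℝ) ^ i) / (total n N : ℝ) =
      ∏ i ∈ Icc 1 n, ((N.choose i : ℝ) / (N : ℝ) ^ i)⁻¹ := by
    intro N
    rw [total, Nat.cast_prod, ← Finset.prod_div_distrib]
    simp only [inv_div]
  simp only [this]
  refine tendsto_finsetProd _ fun i _ => ?_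
  have := (tendsto_choose_div i).inv₀ (by positivity)
  simpa using this

/-- For large `N` the columns are distinct and on the ring. -/
lemma eventually_floor {n : ℕ} {q : Fin n → ℝ} (hq : q ∈ domain n) :
    ∀ᶠ N : ℕ in atTop, ∃ b : Fin n → Fin N, StrictMono b ∧
      ∀ a, (b a).val = ⌊(N : ℝ) * q a⌋₊ := by
  have h1 : ∀ᶠ N : ℕ in atTop, ∀ i j, i < j → ⌊(N : ℝ) * q i⌋₊ < ⌊(N : ℝ) * q j⌋₊ := by
    rw [eventually_all]
    intro i
    rw [eventually_all]
    intro j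
    by_cases hij : i < j
    · filter_upwards [(tendsto_floor_mul_div _ (hq.2 i).1).eventually_lt
        (tendsto_floor_mul_div _ (hq.2 j).1) (hq.1 hij)] with N hN _
      by_contra h
      exact absurd hN (not_lt.2 
        (div_le_div_of_nonneg_right (Nat.cast_le.2 (not_lt.1 h)) (Nat.cast_nonneg N)))
    · exact Eventually.of_forall fun t h => absurd h hij
  filter_upwards [h1, eventually_gt_atTop 0] with N h1 hN
  have hN' : (0 : ℝ) < N := by exact_mod_cast hN
  refine ⟨fun a => ⟨⌊(N : ℝ) * q a⌋₊, ?_⟩, fun i j hij => h1 i j hij, fun a => rfl⟩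
  rw [Nat.floor_lt (mul_nonneg hN'.le (hq.2 a).1)]
  exact (mul_lt_iff_lt_one_right hN').2 (hq.2 a).2

/-- The cell factor times the order of `phiDet n 0` is the order of the total count, so the limit is
finite. -/
lemma prod_pow_range (n N : ℕ) :
    (N : ℝ) ^ (n + 1) * ∏ i ∈ range (n + 1), (N : ℝ) ^ i = ∏ i ∈ Icc 1 (n + 1), (N : ℝ) ^ i := by
  induction n with
  | zero => simp
  | succ n ih =>
    rw [Finset.prod_Icc_succ_top (by omega), ← ih, Finset.prod_range_succ _ (n + 1)]
    ring

theorem tendsto_scaledProb_w0 {n : ℕ} {q : Fin (n + 1) → ℝ} (hq : q ∈ domain (n + 1)) :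
    Tendsto (scaledProb (w0 (n + 1)) q) atTop
      (𝓝 ((∏ i ∈ Icc 1 (n + 1), (i.factorial : ℝ)) * psiDet n 0 fun j => q j.rev)) := by
  refine ((tendsto_total (n + 1)).mul
    (tendsto_phiDet n 0 (by omega) _ fun j => (hq.2 j.rev).1)).congr' ?_
  filter_upwards [eventually_floor hq, eventually_gt_atTop 0] with N ⟨b, hb, hbq⟩ hN
  have hN' : (N : ℝ) ≠ 0 := by exact_mod_cast hN.ne'
  have hp : StrictAnti (b ∘ Fin.rev) := fun i j h => hb (Fin.rev_lt_rev.2 h)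
  have hc : (count (w0 (n + 1)) (fun a => ⌊(N : ℝ) * q a⌋₊) N : ℝ) =
      phiDet n 0 fun j => ⌊(N : ℝ) * q j.rev⌋₊ := by
    have h1 := count_eq_weight (w0 (n + 1)) (b ∘ Fin.rev)
    simp only [w0, Function.comp_apply, Fin.revPerm_apply, Fin.rev_rev, hbq] at h1
    rw [w0, h1, weight_of_strictAnti n hp]
    simp only [Function.comp_apply, hbq]
  rw [scaledProb, hc, ← prod_pow_range]
  have h2 : (∏ i ∈ range (n + 1), (N : ℝ) ^ i) ≠ 0 :=
    Finset.prod_ne_zero_iff.2 fun i _ => pow_ne_zero _ hN'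
  field_simp

theorem tendsto_scaledProb_skw0 {n k : ℕ} (hk : k = 1 ∨ k = 2) (hkn : k < n + 1)
    {q : Fin (n + 1) → ℝ} (hq : q ∈ domain (n + 1)) :
    Tendsto (scaledProb (skw0 (n + 1) k hkn) q) atTop
      (𝓝 ((∏ i ∈ Icc 1 (n + 1), (i.factorial : ℝ)) *
        (1 / k.factorial * (psiDet n k fun j => q j.rev) - psiDet n 0 fun j => q j.rev))) := by
  have hq0 : ∀ j : Fin (n + 1), 0 ≤ q j.rev := fun j => (hq.2 j.rev).1
  refine ((tendsto_total (n + 1)).mul (((tendsto_choose_div k).mul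
    (tendsto_phiDet n k (by omega) _ hq0)).sub (tendsto_phiDet n 0 (by omega) _ hq0))).congr' ?_
  filter_upwards [eventually_floor hq, eventually_gt_atTop 0] with N ⟨b, hb, hbq⟩ hN
  have hN' : (N : ℝ) ≠ 0 := by exact_mod_cast hN.ne'
  have hp : StrictAnti (b ∘ Fin.rev) := fun i j h => hb (Fin.rev_lt_rev.2 h)
  obtain ⟨a, rfl⟩ : ∃ a, k = a + 1 := ⟨k - 1, by omega⟩
  have hc : (count (skw0 (n + 1) (a + 1) hkn) (fun a => ⌊(N : ℝ) * q a⌋₊) N : ℝ) =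
      N.choose (a + 1) * (phiDet n (a + 1) fun j => ⌊(N : ℝ) * q j.rev⌋₊) -
        phiDet n 0 fun j => ⌊(N : ℝ) * q j.rev⌋₊ := by
    have h1 := count_eq_weight (skw0 (n + 1) (a + 1) hkn) ((b ∘ Fin.rev) ∘ adjSwap _ a hkn)
    have e : ∀ x, adjSwap (n + 1) a hkn (skw0 (n + 1) (a + 1) hkn x) = x.rev := fun x =>
      Equiv.swap_apply_self _ _ _
    simp only [Function.comp_apply, e, Fin.rev_rev, hbq] at h1
    rw [h1, weight_swap (by omega) n hkn hp]
    simp only [Function.comp_apply, hbq]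
  rw [scaledProb, hc, ← prod_pow_range]
  have h2 : (∏ i ∈ range (n + 1), (N : ℝ) ^ i) ≠ 0 :=
    Finset.prod_ne_zero_iff.2 fun i _ => pow_ne_zero _ hN'
  field_simp

end TASEP

theorem mainTheorem7 (n k : ℕ) (hk : k = 1 ∨ k = 2) (hkn : k < n) :
    (∀ q ∈ TASEP.domain n, Filter.Tendsto (TASEP.scaledProb (TASEP.w0 n) q) Filter.atTop
      (nhds (TASEP.density (TASEP.w0 n) q))) ∧
    (∀ q ∈ TASEP.domain n, Filter.Tendsto (TASEP.scaledProb (TASEP.skw0 n k hkn) q) Filter.atTop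
      (nhds (TASEP.density (TASEP.skw0 n k hkn) q))) ∧
    ContDiffOn ℝ k (TASEP.density (TASEP.w0 n)) (TASEP.domain n) ∧
    ∀ q ∈ TASEP.domain n,
      TASEP.density (TASEP.skw0 n k hkn) q =
        1 / (k.factorial : ℝ) * TASEP.lastPartials k (TASEP.density (TASEP.w0 n)) q
          - TASEP.density (TASEP.w0 n) q := by
  obtain ⟨n, rfl⟩ : ∃ m, n = m + 1 := ⟨n - 1, by omega⟩
  have h0 : ∀ q ∈ TASEP.domain (n + 1), TASEP.density (TASEP.w0 (n + 1)) q =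
      (∏ i ∈ Finset.Icc 1 (n + 1), (i.factorial : ℝ)) * TASEP.psiDet n 0 fun j => q j.rev :=
    fun q hq => (TASEP.tendsto_scaledProb_w0 hq).limUnder_eq
  have h1 := fun q (hq : q ∈ TASEP.domain (n + 1)) =>
    (TASEP.tendsto_scaledProb_skw0 hk hkn hq).limUnder_eq
  refine ⟨fun q hq => ?_, fun q hq => ?_, ?_, fun q hq => ?_⟩
  · rw [h0 q hq]
    exact TASEP.tendsto_scaledProb_w0 hq
  · exact tendsto_nhds_limUnder ⟨_, TASEP.tendsto_scaledProb_skw0 hk hkn hq⟩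
  · exact (contDiff_const.mul (TASEP.contDiff_psiDet n 0 k)).contDiffOn.congr h0
  · rw [TASEP.lastPartials_eq _ _ h0 k (by omega) q hq, h0 q hq]
    refine (h1 q hq).trans ?_
    ring
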